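/- Let $\mathfrak S_n$ denote the set of permutations $\sigma=\sigma_1\cdots\sigma_n$ of $\{1,\dots,n\}$. A permutation $\sigma\in\mathfrak S_n$ contains $\pi\in\mathfrak S_k$ as a pattern if $\sigma$ has a subsequence of length $k$ whose entries are in the same relative order as those of $\pi$; otherwise $\sigma$ avoids $\pi$. For a set $\Pi$ of permutations let $\mathfrak S_n(\Pi)$ be the set of $\sigma\in\mathfrak S_n$ that avoid every $\pi\in\Pi$. For $S\subseteq\{1,\dots,n-1\}$ let $F_S=\sum x_{i_1}x_{i_2}\cdots x_{i_n}\in\mathbb R[[x_1,x_2,\dots]]$, the sum over all $i_1\le i_2\le\dots\le i_n$ with $i_j<i_{j+1}$ whenever $j\in S$, be the fundamental quasisymmetric function of degree $n$ associated with $S$. Let $\operatorname{Des}\sigma=\{i\mid\sigma_i>\sigma_{i+1}\}$ and $$Q_n(\Pi)=\sum_{\sigma\in\mathfrak S_n(\Pi)}F_{\operatorname{Des}\sigma}.$$ A power series in $\mathbb R[[x_1,x_2,\dots]]$ is symmetric if it has bounded degree and is invariant under all permutations of the variables. Let $\iota_k=12\cdots k$ and $\delta_k=k\cdots21$. **Theorem.**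 Suppose $\#\Pi=1$. Then $Q_n(\Pi)$ is symmetric for all $n\ge0$ if and only if $\Pi=\{\iota_k\}$ or $\Pi=\{\delta_k\}$ for some $k$. -/

import Mathlib

namespace PatternQSym

/-- A permutation of unspecified length `k`; `⟨k, π⟩` has one-line notation
`π 0, π 1, …, π (k - 1)` (positions and values are numbered from `0`). -/
abbrev Pattern : Type := Σ k : ℕ, Equiv.Perm (Fin k)

/-- The increasing permutation of length `k`. -/
def iota (k : ℕ) : Equiv.Perm (Fin k) := Equiv.refl (Fin k)

/-- The decreasing permutation of length `k`. -/
def delta (k : ℕ) : Equiv.Perm (Fin k) := Fin.revPerm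

/-- `σ` contains `π` as a pattern: some subsequence of `σ`, taken at the positions
`f 0 < f 1 < …`, has its entries in the same relative order as `π`. -/
def Contains {n k : ℕ} (σ : Equiv.Perm (Fin n)) (π : Equiv.Perm (Fin k)) : Prop :=
  ∃ f : Fin k ↪o Fin n, ∀ i j : Fin k, σ (f i) < σ (f j) ↔ π i < π j

/-- `σ` avoids every permutation in the set `P`. -/
def Avoids {n : ℕ} (σ : Equiv.Perm (Fin n)) (P : Set Pattern) : Prop :=
  ∀ p ∈ P, ¬ Contains σ p.2

/-- The descent set of `σ`; since positions are numbered from `0`, `i` is in it when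
the entry at position `i` is larger than the one at position `i + 1`. -/
def descentSet {n : ℕ} (σ : Equiv.Perm (Fin n)) : Set ℕ :=
  {i | ∃ h : i + 1 < n, σ ⟨i + 1, h⟩ < σ ⟨i, Nat.lt_of_succ_lt h⟩}

/-- The weakly increasing index sequences `i 0 ≤ i 1 ≤ … ≤ i (n - 1)` with
`i j < i (j + 1)` for `j ∈ S`, whose monomial `x_(i 0) ⋯ x_(i (n - 1))` has exponent `d`. -/
def indexSeqs (n : ℕ) (S : Set ℕ) (d : ℕ →₀ ℕ) : Set (Fin n → ℕ) :=
  {i | Monotone i ∧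
    (∀ (j : ℕ) (h : j + 1 < n), j ∈ S → i ⟨j, Nat.lt_of_succ_lt h⟩ < i ⟨j + 1, h⟩) ∧
    ∑ j : Fin n, Finsupp.single (i j) 1 = d}

/-- Each monomial arises from only finitely many index sequences, so counting them by
`Set.ncard` is meaningful. -/
theorem indexSeqs_finite (n : ℕ) (S : Set ℕ) (d : ℕ →₀ ℕ) : (indexSeqs n S d).Finite := by
  refine Set.Finite.subset
    (Set.Finite.pi' (t := fun _ : Fin n => (d.support : Set ℕ)) fun _ => d.support.finite_toSet) ?_
  rintro i ⟨-, -, rfl⟩ j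
  have h : 1 ≤ ∑ l : Fin n, (Finsupp.single (i l) 1 : ℕ →₀ ℕ) (i j) := by
    refine le_trans ?_ (Finset.single_le_sum
      (f := fun l => (Finsupp.single (i l) 1 : ℕ →₀ ℕ) (i j))
      (fun _ _ => Nat.zero_le _) (Finset.mem_univ j))
    simp
  simp only [Finset.mem_coe, Finsupp.mem_support_iff, Finsupp.finsetSum_apply]
  omega

/-- The fundamental quasisymmetric function of degree `n` of the set `S`: the sum of the
monomials `x_(i 0) ⋯ x_(i (n - 1))` over `i 0 ≤ … ≤ i (n - 1)` with `i j < i (j + 1)` for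
`j ∈ S`, given by its coefficients. The countably many variables are indexed by `ℕ`. -/
noncomputable def fundamental (n : ℕ) (S : Set ℕ) : MvPowerSeries ℕ ℝ :=
  fun d => ((indexSeqs n S d).ncard : ℝ)

open Classical in
/-- The sum of the fundamental quasisymmetric functions of the descent sets of the
permutations of length `n` that avoid `P`. -/
noncomputable def Q (n : ℕ) (P : Set Pattern) : MvPowerSeries ℕ ℝ :=
  ∑ σ : Equiv.Perm (Fin n) with Avoids σ P, fundamental n (descentSet σ)

/-- A symmetric function: a formal power series of bounded degree that is invariant under
all permutations of the variables. -/
def IsSymmetricFunction (f : MvPowerSeries ℕ ℝ) : Prop :=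
  (∃ N : ℕ, ∀ d : ℕ →₀ ℕ, MvPowerSeries.coeff d f ≠ 0 → d.degree ≤ N) ∧
    ∀ e : Equiv.Perm ℕ, MvPowerSeries.rename e f = f

end PatternQSym

/-! The stable sorting permutation `Tuple.sort w` of a word `w` (the inverse of its standardization)
turns `Q n P` into a generating function of words: the coefficient at `d` counts the words of
content `d` whose sorting permutation avoids `P` (`coeff_Q`). Symmetry means that this count is
unchanged when the letters are permuted in `d`.

Necessity needs only `n = k`. Counting all words by content is symmetric, so the contents of the
words sorted by `π` are closed under permuting letters. The content with each of `0, …, k - 2` once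
and one further `p` occurs exactly when `p` is not a descent of `π`. These contents are permutations
of one another, so all positions of `π` are descents or none is.

For sufficiency, `Tuple.sort w` contains `iota k` or `delta k` exactly when `w` has a weakly
increasing or strictly decreasing subsequence of length `k`. The crystal operators, which exchange
one `a` with one `a + 1` at a pivot, preserve this (`exists_monotoneOn_update`,
`exists_strictAntiOn_update`). Iterating them matches contents that differ by swapping `a` and `a +
1` (`ncard_content_swap`), and adjacent swaps suffice. -/

namespace PatternQSym

/-! ### Coefficients of `Q` as counts of words -/

/-- The exponent vector of a word: the number of occurrences of each letter. -/
noncomputable def content {n : ℕ} (w : Fin n → ℕ) : ℕ →₀ ℕ := ∑ j, Finsupp.single (w j) 1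

theorem content_apply {n : ℕ} (w : Fin n → ℕ) (x : ℕ) :
    content w x = (Finset.univ.filter fun j => w j = x).card := by
  simp [content, Finsupp.finsetSum_apply, Finsupp.single_apply]

theorem content_comp_perm {n : ℕ} (w : Fin n → ℕ) (σ : Equiv.Perm (Fin n)) :
    content (w ∘ σ) = content w :=
  Equiv.sum_comp σ fun j => Finsupp.single (w j) 1

theorem content_degree {n : ℕ} (w : Fin n → ℕ) : (content w).degree = n := by
  simp [content, map_sum]

theorem content_comp_letters {n : ℕ} (w : Fin n → ℕ) (e : Equiv.Perm ℕ) :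
    content (e ∘ w) = Finsupp.mapDomain e (content w) := by
  simp [content, Finsupp.mapDomain_finsetSum, Finsupp.mapDomain_single]

theorem finite_setOf_content_eq (n : ℕ) (d : ℕ →₀ ℕ) :
    {w : Fin n → ℕ | content w = d}.Finite := by
  refine Set.Finite.subset
    (Set.Finite.pi' (t := fun _ : Fin n => (d.support : Set ℕ)) fun _ => d.support.finite_toSet) ?_
  rintro w rfl j
  rw [Finset.mem_coe, Finsupp.mem_support_iff, content_apply]
  exact Finset.card_ne_zero_of_mem (Finset.mem_filter.2 ⟨Finset.mem_univ j, rfl⟩)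

/-- A plateau of a monotone `i` is an interval of positions. If `i` is strict at descents, the
interval contains none, so `σ` increases along it. The right-hand side is the tie-breaking rule of
stable sorting. -/
theorem forall_descentSet_lt_iff {n : ℕ} (σ : Equiv.Perm (Fin n)) {i : Fin n → ℕ}
    (hi : Monotone i) :
    (∀ (j : ℕ) (h : j + 1 < n), j ∈ descentSet σ →
        i ⟨j, Nat.lt_of_succ_lt h⟩ < i ⟨j + 1, h⟩) ↔
      ∀ a b, a < b → i a = i b → σ a < σ b := by
  constructor
  · intro H a b hab heq
    obtain ⟨b, hb⟩ := b
    have hab' : a.1 + 1 ≤ b := hab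
    induction b, hab' using Nat.le_induction with
    | base =>
      by_contra hlt
      refine (H a hb ⟨hb, lt_of_le_of_ne (not_lt.1 hlt) fun h => ?_⟩).ne heq
      exact absurd (congrArg Fin.val (σ.injective h)) (by simp)
    | succ m hm ih =>
      have h1 : i a ≤ i ⟨m, by omega⟩ := hi (Fin.le_def.2 (by simp; omega))
      have h2 : i ⟨m, by omega⟩ ≤ i ⟨m + 1, hb⟩ := hi (Fin.le_def.2 (by simp))
      refine (ih (by omega) (Fin.lt_def.2 hm) (by omega)).trans ?_
      by_contra hlt
      refine absurd (H m hb ⟨hb, lt_of_le_of_ne (not_lt.1 hlt) fun h => ?_⟩) (by omega)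
      exact absurd (congrArg Fin.val (σ.injective h)) (by simp)
  · rintro H j h ⟨_, hj⟩
    refine lt_of_le_of_ne (hi (Fin.le_def.2 (by simp))) fun heq => ?_
    exact absurd (H _ _ (Fin.lt_def.2 (by simp)) heq) hj.not_gt

theorem mem_indexSeqs_iff {n : ℕ} (σ : Equiv.Perm (Fin n)) (d : ℕ →₀ ℕ) (w : Fin n → ℕ) :
    w ∘ σ ∈ indexSeqs n (descentSet σ) d ↔ content w = d ∧ Tuple.sort w = σ := by
  rw [eq_comm (b := σ), Tuple.eq_sort_iff, and_comm]
  change _ ∧ _ ∧ content (w ∘ σ) = d ↔ _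
  rw [content_comp_perm, ← and_assoc]
  refine and_congr_left fun _ => and_congr_right fun h => ?_
  exact forall_descentSet_lt_iff σ h

/-- The bijection is `w ↦ w ∘ σ`, which sorts the word. -/
theorem ncard_indexSeqs {n : ℕ} (σ : Equiv.Perm (Fin n)) (d : ℕ →₀ ℕ) :
    (indexSeqs n (descentSet σ) d).ncard =
      {w : Fin n → ℕ | content w = d ∧ Tuple.sort w = σ}.ncard := by
  symm
  refine Set.ncard_congr (fun w _ => w ∘ σ) (fun w hw => (mem_indexSeqs_iff σ d w).2 hw) ?_ ?_
  · intro v w _ _ h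
    exact σ.surjective.injective_comp_right h
  · intro i hi
    have : (i ∘ σ.symm) ∘ σ = i := by ext; simp
    exact ⟨i ∘ σ.symm, (mem_indexSeqs_iff σ d _).1 (by rwa [this]), this⟩

theorem coeff_Q (n : ℕ) (P : Set Pattern) (d : ℕ →₀ ℕ) :
    MvPowerSeries.coeff d (Q n P) =
      ({w : Fin n → ℕ | content w = d ∧ Avoids (Tuple.sort w) P}.ncard : ℝ) := by
  classical
  have hfin : {w : Fin n → ℕ | content w = d ∧ Avoids (Tuple.sort w) P}.Finite :=
    (finite_setOf_content_eq n d).subset fun w hw => hw.1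
  rw [Set.ncard_eq_toFinset_card _ hfin, Q, map_sum,
    Finset.card_eq_sum_card_fiberwise (f := Tuple.sort)
      (t := Finset.univ.filter fun σ => Avoids σ P), Nat.cast_sum]
  · refine Finset.sum_congr (by ext; simp) fun σ hσ => ?_
    change ((indexSeqs n (descentSet σ) d).ncard : ℝ) = _
    rw [ncard_indexSeqs, ← Set.ncard_coe_finset]
    congr 2
    ext w
    have := (Finset.mem_filter.1 hσ).2
    simp only [Set.mem_ofPred_eq, Finset.coe_filter, Set.Finite.mem_toFinset]
    constructor
    · rintro ⟨h1, rfl⟩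
      exact ⟨⟨h1, this⟩, rfl⟩
    · rintro ⟨⟨h1, _⟩, h2⟩
      exact ⟨h1, h2⟩
  · intro w hw
    simpa using ((hfin.mem_toFinset).1 hw).2

theorem isSymmetricFunction_Q_iff (n : ℕ) (P : Set Pattern) :
    IsSymmetricFunction (Q n P) ↔ ∀ (e : Equiv.Perm ℕ) (d : ℕ →₀ ℕ),
      {w : Fin n → ℕ | content w = Finsupp.mapDomain e d ∧ Avoids (Tuple.sort w) P}.ncard =
        {w : Fin n → ℕ | content w = d ∧ Avoids (Tuple.sort w) P}.ncard := by
  have key (e : Equiv.Perm ℕ) (d : ℕ →₀ ℕ) :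
      MvPowerSeries.coeff (Finsupp.mapDomain e d) (MvPowerSeries.rename e (Q n P)) =
        MvPowerSeries.coeff d (Q n P) := by
    have := MvPowerSeries.coeff_embDomain_rename e.toEmbedding (Q n P) d
    rwa [Finsupp.embDomain_eq_mapDomain] at this
  constructor
  · rintro ⟨-, h⟩ e d
    have := key e d
    rw [h e, coeff_Q, coeff_Q] at this
    exact_mod_cast this
  · intro h
    refine ⟨⟨n, fun d hd => ?_⟩, fun e => ?_⟩
    · rw [coeff_Q, Nat.cast_ne_zero] at hd
      obtain ⟨w, rfl, -⟩ := Set.nonempty_of_ncard_ne_zero hd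
      exact (content_degree w).le
    · ext d
      obtain ⟨d, rfl⟩ : ∃ d', Finsupp.mapDomain e d' = d :=
        ⟨Finsupp.mapDomain e.symm d, by rw [← Finsupp.mapDomain_comp]; simp⟩
      rw [key, coeff_Q, coeff_Q, h]

/-! ### Necessity: the coefficients in degree `k` -/

theorem contains_same_length_iff {n : ℕ} (σ π : Equiv.Perm (Fin n)) :
    Contains σ π ↔ σ = π := by
  constructor
  · rintro ⟨f, hf⟩
    have hid : ∀ i, f i = i := fun i => by
      refine congrFun ((f.strictMono.range_inj strictMono_id).1 ?_) i
      rw [(Finite.surjective_of_injective f.injective).range_eq, Set.range_id]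
    simp only [hid] at hf
    have hmono : StrictMono (σ ∘ π.symm) := fun a b hab => by
      simpa using (hf (π.symm a) (π.symm b)).2 (by simpa using hab)
    have := (Equiv.Perm.monotone_iff (π.symm.trans σ)).1 hmono.monotone
    refine Equiv.ext fun i => ?_
    simpa using DFunLike.congr_fun this (π i)
  · rintro rfl
    exact ⟨RelEmbedding.refl _, fun _ _ => Iff.rfl⟩

theorem avoids_singleton {n k : ℕ} (σ : Equiv.Perm (Fin n)) (π : Equiv.Perm (Fin k)) :
    Avoids σ {⟨k, π⟩} ↔ ¬ Contains σ π := by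
  simp [Avoids]

/-- The content determines the sorted word, and the sorting permutation says how to undo the
sorting. -/
theorem sort_injOn_content {n : ℕ} {v w : Fin n → ℕ} (hc : content v = content w)
    (hs : Tuple.sort v = Tuple.sort w) : v = w := by
  have hv := Tuple.monotone_sort v
  have hw := Tuple.monotone_sort w
  have hm : (Finset.univ : Finset (Fin n)).val.map v = Finset.univ.val.map w := by
    ext x
    have := DFunLike.congr_fun hc x
    rw [content_apply, content_apply] at this
    simp only [Multiset.count_map, Finset.card_def, Finset.filter_val] at this ⊢
    simpa only [eq_comm (a := x)] using this
  have hperm : (List.ofFn v).Perm (List.ofFn w) := by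
    rw [← Multiset.coe_eq_coe]
    simpa [Fin.univ_def, List.ofFn_eq_map] using hm
  have h := List.Perm.eq_of_sortedLE hv.sortedLE_ofFn hw.sortedLE_ofFn
    (((Tuple.sort v).ofFn_comp_perm v).trans
      (hperm.trans ((Tuple.sort w).ofFn_comp_perm w).symm))
  have h := List.ofFn_injective h
  rw [hs] at h
  exact (Tuple.sort w).surjective.injective_comp_right h

/-- If `Q_k` of a single pattern of length `k` is symmetric, then the contents of the words
which standardize to the pattern are closed under permutations of the letters. -/
theorem exists_sort_eq_of_isSymmetric {k : ℕ} {π : Equiv.Perm (Fin k)}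
    (h : IsSymmetricFunction (Q k {⟨k, π⟩})) (e : Equiv.Perm ℕ) {v : Fin k → ℕ}
    (hv : Tuple.sort v = π) :
    ∃ w : Fin k → ℕ, content w = Finsupp.mapDomain e (content v) ∧ Tuple.sort w = π := by
  by_contra! hno
  have h := (isSymmetricFunction_Q_iff k _).1 h e (content v)
  simp only [avoids_singleton, contains_same_length_iff] at h
  -- If no word of the permuted content sorts to `π`, that side counts every word of its content.
  -- The other side counts equally many words but omits `v`.
  have h1 : {w : Fin k → ℕ | content w = Finsupp.mapDomain e (content v) ∧ ¬ Tuple.sort w = π} =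
      (fun w => e ∘ w) '' {w : Fin k → ℕ | content w = content v} := by
    ext w
    constructor
    · rintro ⟨hw, -⟩
      refine ⟨e.symm ∘ w, ?_, by ext; simp⟩
      change content _ = _
      rw [content_comp_letters, hw, ← Finsupp.mapDomain_comp]
      simp
    · rintro ⟨u, hu, rfl⟩
      have : content (e ∘ u) = Finsupp.mapDomain e (content v) := by
        rw [content_comp_letters, show content u = content v from hu]
      exact ⟨this, hno _ this⟩
  rw [h1, Set.ncard_image_of_injective _ e.injective.comp_left] at h
  refine (Set.ncard_lt_ncard ?_ (finite_setOf_content_eq k (content v))).ne' h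
  refine ⟨fun w hw => hw.1, fun hsub => ?_⟩
  exact (hsub (show content v = content v from rfl)).2 hv

/-- The weakly increasing word `0 1 ⋯ p p (p + 1) ⋯`. -/
def repeatWord (k p : ℕ) : Fin k → ℕ := fun j => if j.1 ≤ p then j.1 else j.1 - 1

theorem monotone_repeatWord (k p : ℕ) : Monotone (repeatWord k p) := by
  intro a b hab
  have : a.1 ≤ b.1 := hab
  unfold repeatWord
  split_ifs <;> omega

theorem content_repeatWord {k p : ℕ} (hp : p + 1 < k) :
    content (repeatWord k p) =
      (∑ x ∈ Finset.range (k - 1), Finsupp.single x 1) + Finsupp.single p 1 := by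
  obtain ⟨k, rfl⟩ : ∃ m, k = m + 1 := ⟨k - 1, by omega⟩
  -- Position `p + 1` carries the second copy of `p`; without it, each letter occurs once.
  rw [content, Fin.sum_univ_succAbove _ (⟨p + 1, hp⟩ : Fin (k + 1)), add_comm,
    Finset.sum_range]
  congr 1
  · refine Finset.sum_congr rfl fun j _ => ?_
    congr 1
    simp only [repeatWord, Fin.succAbove, Fin.lt_def]
    split_ifs <;> simp_all; omega
  · congr 1
    simp [repeatWord]

theorem mapDomain_swap_content_repeatWord {k p q : ℕ} (hp : p + 1 < k) (hq : q + 1 < k) :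
    Finsupp.mapDomain (Equiv.swap p q) (content (repeatWord k p)) =
      content (repeatWord k q) := by
  rw [content_repeatWord hp, content_repeatWord hq, Finsupp.mapDomain_add,
    Finsupp.mapDomain_finsetSum]
  simp only [Finsupp.mapDomain_single, Equiv.swap_apply_left]
  congr 1
  refine Finset.sum_equiv (Equiv.swap p q) (fun x => ?_) fun x _ => rfl
  simp only [Finset.mem_range, Equiv.swap_apply_def]
  split_ifs <;> omega

theorem sort_repeatWord_comp_eq_iff {k p : ℕ} (hp : p + 1 < k) (π : Equiv.Perm (Fin k)) :
    Tuple.sort (repeatWord k p ∘ π.symm) = π ↔ p ∉ descentSet π := by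
  have hc : (repeatWord k p ∘ π.symm) ∘ π = repeatWord k p := by ext; simp
  rw [eq_comm, Tuple.eq_sort_iff, hc, and_iff_right (monotone_repeatWord k p)]
  constructor
  · rintro H ⟨_, hd⟩
    refine absurd (H ⟨p, by omega⟩ ⟨p + 1, hp⟩ (Fin.lt_def.2 (by simp)) ?_) hd.not_gt
    simp [repeatWord]
  · intro hd a b hab heq
    have hab' : a.1 < b.1 := hab
    simp only [Function.comp, Equiv.symm_apply_apply, repeatWord] at heq
    have ha : a = ⟨p, by omega⟩ := Fin.ext (by simp only; split_ifs at heq <;> omega)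
    have hb : b = ⟨p + 1, hp⟩ := Fin.ext (by simp only; split_ifs at heq <;> omega)
    rw [ha, hb]
    by_contra hlt
    refine hd ⟨hp, lt_of_le_of_ne (not_lt.1 hlt) fun h => ?_⟩
    exact absurd (congrArg Fin.val (π.injective h)) (by simp)

theorem not_mem_descentSet_of_isSymmetric {k p q : ℕ} {π : Equiv.Perm (Fin k)}
    (h : IsSymmetricFunction (Q k {⟨k, π⟩})) (hp : p + 1 < k) (hq : q + 1 < k)
    (hpπ : p ∉ descentSet π) : q ∉ descentSet π := by
  obtain ⟨w, hw, hs⟩ := exists_sort_eq_of_isSymmetric h (Equiv.swap p q)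
    ((sort_repeatWord_comp_eq_iff hp π).2 hpπ)
  rw [content_comp_perm, mapDomain_swap_content_repeatWord hp hq] at hw
  have hwπ : w ∘ π = repeatWord k q := by
    have h1 : Tuple.sort (w ∘ π) = Tuple.sort (repeatWord k q) := by
      rw [Tuple.sort_eq_refl_iff_monotone.2 (monotone_repeatWord k q),
        Tuple.sort_eq_refl_iff_monotone, ← hs]
      exact Tuple.monotone_sort w
    exact sort_injOn_content (by rw [content_comp_perm, hw]) h1
  rw [← sort_repeatWord_comp_eq_iff hq, ← hwπ]
  convert hs
  ext; simp

theorem eq_iota_or_delta_of_isSymmetric {k : ℕ} {π : Equiv.Perm (Fin k)}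
    (h : IsSymmetricFunction (Q k {⟨k, π⟩})) : π = iota k ∨ π = delta k := by
  have hmono : ∀ {τ : Equiv.Perm (Fin k)}, (∀ p, p + 1 < k → p ∉ descentSet τ) → τ = 1 := by
    intro τ hτ
    rw [← Equiv.Perm.monotone_iff]
    rcases k with _ | k
    · exact fun a => a.elim0
    · refine Fin.monotone_iff_le_succ.2 fun i => ?_
      by_contra hlt
      exact hτ i.1 (by omega) ⟨by omega, not_le.1 hlt⟩
  by_cases hall : ∃ p, p + 1 < k ∧ p ∉ descentSet π
  · obtain ⟨p, hp, hpπ⟩ := hall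
    exact Or.inl (hmono fun q hq => not_mem_descentSet_of_isSymmetric h hp hq hpπ)
  · push Not at hall
    right
    -- Reversing the values turns the descents of `π` into ascents.
    have := hmono (τ := π.trans Fin.revPerm) fun p hp => by
      rintro ⟨_, hd⟩
      obtain ⟨_, hd'⟩ := hall p hp
      simp only [Equiv.trans_apply, Fin.revPerm_apply, Fin.rev_lt_rev] at hd
      exact absurd hd hd'.not_gt
    ext i
    have := DFunLike.congr_fun this i
    simp only [Equiv.trans_apply, Fin.revPerm_apply, Equiv.Perm.one_apply] at this
    rw [delta, Fin.revPerm_apply, ← Fin.rev_inj.2 this, Fin.rev_rev]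

/-! ### Monotone patterns as subsequences of words -/

/-- The entries of `Tuple.sort w` are the positions of `w`, ordered by letter and then from left to
right. An increasing subsequence of entries is thus a set of positions with weakly increasing
letters; the tie-breaking is what admits equal letters here and excludes them for `delta`. -/
theorem contains_sort_iota_iff {n k : ℕ} (w : Fin n → ℕ) :
    Contains (Tuple.sort w) (iota k) ↔
      ∃ I : Finset (Fin n), I.card = k ∧ MonotoneOn w I := by
  obtain ⟨hm, hst⟩ := Tuple.eq_sort_iff.1 (rfl : Tuple.sort w = Tuple.sort w)
  generalize Tuple.sort w = σ at hm hst
  constructor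
  · rintro ⟨f, hf⟩
    refine ⟨Finset.univ.map (f.toEmbedding.trans σ.toEmbedding), by simp, ?_⟩
    intro x hx y hy hxy
    obtain ⟨i, -, rfl⟩ := Finset.mem_map.1 (Finset.mem_coe.1 hx)
    obtain ⟨j, -, rfl⟩ := Finset.mem_map.1 (Finset.mem_coe.1 hy)
    refine hm (f.monotone (not_lt.1 fun hji => ?_))
    exact absurd ((hf j i).2 hji) hxy.not_gt
  · rintro ⟨I, rfl, hI⟩
    have hlt : ∀ x ∈ I, ∀ y ∈ I, x < y → σ.symm x < σ.symm y := fun x hx y hy hxy => by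
      by_contra hlt
      have hlt' := lt_of_le_of_ne (not_lt.1 hlt) (σ.symm.injective.ne hxy.ne')
      have h1 : w y ≤ w x := by simpa using hm hlt'.le
      have h2 := hst _ _ hlt' (by simpa using le_antisymm h1 (hI hx hy hxy.le))
      exact absurd hxy (by simpa using h2.le)
    let f := (I.map σ.symm.toEmbedding).orderEmbOfFin (k := I.card) (by simp)
    have hf : ∀ i, σ (f i) ∈ I := fun i => by
      have := (I.map σ.symm.toEmbedding).orderEmbOfFin_mem (k := I.card) (by simp) i
      rw [Finset.mem_map_equiv] at this
      simpa using this
    have hmono : StrictMono fun i => σ (f i) := fun i j hij => by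
      by_contra hle
      rcases (not_lt.1 hle).lt_or_eq with h | h
      · have := hlt _ (hf j) _ (hf i) h
        simp only [Equiv.symm_apply_apply] at this
        exact absurd (f.strictMono hij) this.not_gt
      · exact absurd (f.injective (σ.injective h)) hij.ne'
    exact ⟨f, fun i j => hmono.lt_iff_lt⟩

theorem contains_sort_delta_iff {n k : ℕ} (w : Fin n → ℕ) :
    Contains (Tuple.sort w) (delta k) ↔
      ∃ I : Finset (Fin n), I.card = k ∧ StrictAntiOn w I := by
  obtain ⟨hm, hst⟩ := Tuple.eq_sort_iff.1 (rfl : Tuple.sort w = Tuple.sort w)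
  generalize Tuple.sort w = σ at hm hst
  simp only [delta, Contains, Fin.revPerm_apply, Fin.rev_lt_rev]
  constructor
  · rintro ⟨f, hf⟩
    refine ⟨Finset.univ.map (f.toEmbedding.trans σ.toEmbedding), by simp, ?_⟩
    intro x hx y hy hxy
    obtain ⟨i, -, rfl⟩ := Finset.mem_map.1 (Finset.mem_coe.1 hx)
    obtain ⟨j, -, rfl⟩ := Finset.mem_map.1 (Finset.mem_coe.1 hy)
    have hji : f j < f i := f.strictMono ((hf i j).1 hxy)
    refine lt_of_le_of_ne (hm hji.le) fun heq => ?_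
    exact absurd (hst _ _ hji heq) hxy.not_gt
  · rintro ⟨I, rfl, hI⟩
    have hlt : ∀ x ∈ I, ∀ y ∈ I, x < y → σ.symm y < σ.symm x := fun x hx y hy hxy => by
      by_contra hle
      have h1 : w x ≤ w y := by simpa using hm (not_lt.1 hle)
      exact absurd (hI hx hy hxy) h1.not_gt
    let f := (I.map σ.symm.toEmbedding).orderEmbOfFin (k := I.card) (by simp)
    have hf : ∀ i, σ (f i) ∈ I := fun i => by
      have := (I.map σ.symm.toEmbedding).orderEmbOfFin_mem (k := I.card) (by simp) i
      rw [Finset.mem_map_equiv] at this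
      simpa using this
    have hanti : StrictAnti fun i => σ (f i) := fun i j hij => by
      by_contra hle
      rcases (not_lt.1 hle).lt_or_eq with h | h
      · have := hlt _ (hf i) _ (hf j) h
        simp only [Equiv.symm_apply_apply] at this
        exact absurd (f.strictMono hij) this.not_gt
      · exact absurd (f.injective (σ.injective h)) hij.ne
    exact ⟨f, fun i j => hanti.lt_iff_gt⟩

/-! ### Excess and pivots -/

/-- The contribution of a letter to the excess of the letter `a` over the letter `a + 1`. -/
def letterSign (a x : ℕ) : ℤ := if x = a then 1 else if x = a + 1 then -1 else 0

@[simp] theorem letterSign_self (a : ℕ) : letterSign a a = 1 := by simp [letterSign]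

@[simp] theorem letterSign_succ (a : ℕ) : letterSign a (a + 1) = -1 := by simp [letterSign]

theorem eq_of_letterSign_pos {a x : ℕ} (h : 0 < letterSign a x) : x = a := by
  unfold letterSign at h; split_ifs at h <;> simp_all

theorem eq_of_letterSign_neg {a x : ℕ} (h : letterSign a x < 0) : x = a + 1 := by
  unfold letterSign at h; split_ifs at h <;> simp_all

/-- The number of letters `a` minus the number of letters `a + 1` among the first `t` letters
of a word. -/
def excess {n : ℕ} (a : ℕ) (w : Fin n → ℕ) (t : ℕ) : ℤ :=
  ∑ j : Fin n, if j.1 < t then letterSign a (w j) else 0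

@[simp] theorem excess_zero {n : ℕ} (a : ℕ) (w : Fin n → ℕ) : excess a w 0 = 0 := by
  simp [excess]

theorem excess_succ {n : ℕ} (a : ℕ) (w : Fin n → ℕ) (m : Fin n) :
    excess a w (m + 1) = excess a w m + letterSign a (w m) := by
  rw [← sub_eq_iff_eq_add', excess, excess, ← Finset.sum_sub_distrib, Finset.sum_eq_single m]
  · simp
  · intro j _ hj
    have : j.1 ≠ m.1 := Fin.val_ne_of_ne hj
    split_ifs <;> omega
  · simp

theorem excess_length {n : ℕ} (a : ℕ) (w : Fin n → ℕ) :
    excess a w n = (content w a : ℤ) - content w (a + 1) := by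
  simp only [excess, Fin.is_lt, if_true, content_apply, Finset.card_filter, Nat.cast_sum,
    ← Finset.sum_sub_distrib]
  refine Finset.sum_congr rfl fun j _ => ?_
  unfold letterSign
  split_ifs <;> simp_all

theorem excess_update {n : ℕ} (a : ℕ) (w : Fin n → ℕ) (m : Fin n) (x t : ℕ) :
    excess a (Function.update w m x) t =
      excess a w t + if m.1 < t then letterSign a x - letterSign a (w m) else 0 := by
  rw [← sub_eq_iff_eq_add', excess, excess, ← Finset.sum_sub_distrib, Finset.sum_eq_single m]
  · split_ifs <;> simp
  · intro j _ hj
    simp [Function.update_of_ne hj]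
  · simp

theorem excess_sub_excess {n : ℕ} (a : ℕ) (w : Fin n → ℕ) {s t : ℕ} (hst : s ≤ t) :
    excess a w t - excess a w s =
      ((Finset.univ.filter fun j : Fin n => (s ≤ j.1 ∧ j.1 < t) ∧ w j = a).card : ℤ) -
        (Finset.univ.filter fun j : Fin n => (s ≤ j.1 ∧ j.1 < t) ∧ w j = a + 1).card := by
  simp only [excess, Finset.card_filter, Nat.cast_sum, ← Finset.sum_sub_distrib]
  refine Finset.sum_congr rfl fun j _ => ?_
  unfold letterSign
  split_ifs <;> omega

/-- The positions of a word at which exchanging the letters `a` and `a + 1` is a crystal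
operator. -/
def IsPivot {n : ℕ} (a : ℕ) (w : Fin n → ℕ) (m : Fin n) : Prop :=
  (∀ t : ℕ, t ≤ m → excess a w t ≤ excess a w m) ∧
    ∀ t : ℕ, (m : ℕ) + 1 ≤ t → t ≤ n → excess a w t ≤ excess a w (m + 1)

/-- The inequalities before `m` do not see the letter at `m`, and those after it shift by the same
amount. A pivot therefore remains one after the exchange, which makes the operators reversible. -/
theorem isPivot_update_iff {n a : ℕ} {w : Fin n → ℕ} {m : Fin n} (x : ℕ) :
    IsPivot a (Function.update w m x) m ↔ IsPivot a w m := by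
  refine and_congr (forall₂_congr fun t ht => ?_) (forall₃_congr fun t ht _ => ?_)
  · rw [excess_update, excess_update, if_neg (by omega), if_neg (by omega)]
    simp
  · rw [excess_update, excess_update, if_pos (by omega), if_pos (by omega)]
    simp

theorem IsPivot.eq_of_eq_self {n a : ℕ} {w : Fin n → ℕ} {m m' : Fin n} (h : IsPivot a w m)
    (h' : IsPivot a w m') (hm : w m = a) (hm' : w m' = a) : m = m' := by
  have key : ∀ {i j : Fin n}, IsPivot a w i → IsPivot a w j → w j = a → ¬ i < j := by
    intro i j hi hj hja hij
    have h1 := hj.1 (i + 1) hij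
    have h2 := hi.2 (j + 1) (by simpa using hij.le) j.2
    have h3 := excess_succ a w j
    rw [hja, letterSign_self] at h3
    omega
  exact le_antisymm (not_lt.1 (key h' h hm)) (not_lt.1 (key h h' hm'))

theorem IsPivot.eq_of_eq_succ {n a : ℕ} {w : Fin n → ℕ} {m m' : Fin n} (h : IsPivot a w m)
    (h' : IsPivot a w m') (hm : w m = a + 1) (hm' : w m' = a + 1) : m = m' := by
  have key : ∀ {i j : Fin n}, IsPivot a w i → IsPivot a w j → w i = a + 1 → ¬ i < j := by
    intro i j hi hj hia hij
    have h1 := hj.1 i hij.le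
    have h2 := hi.2 j hij j.2.le
    have h3 := excess_succ a w i
    rw [hia, letterSign_succ] at h3
    omega
  exact le_antisymm (not_lt.1 (key h' h hm')) (not_lt.1 (key h h' hm))

theorem exists_isPivot_eq_self {n a : ℕ} {w : Fin n → ℕ} (h : ∃ t ≤ n, 0 < excess a w t) :
    ∃ m, IsPivot a w m ∧ w m = a := by
  classical
  obtain ⟨t₁, ht₁, hmax⟩ := (Finset.range (n + 1)).exists_max_image (excess a w) ⟨0, by simp⟩
  -- The pivot is the step into the first maximum of the excess; positivity keeps that maximum away
  -- from `0`.
  have hex : ∃ t, t ≤ n ∧ ∀ s ≤ n, excess a w s ≤ excess a w t :=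
    ⟨t₁, by simpa [Nat.lt_succ_iff] using ht₁,
      fun s hs => hmax s (by simpa [Nat.lt_succ_iff] using hs)⟩
  obtain ⟨htn, ht⟩ := Nat.find_spec hex
  have hfirst := fun s => Nat.find_min hex (m := s)
  generalize Nat.find hex = t at htn ht hfirst
  obtain ⟨t₀, ht₀, hpos⟩ := h
  rcases t with _ | m
  · have := ht t₀ ht₀
    simp at this
    omega
  have hlt : ∀ s ≤ m, excess a w s < excess a w (m + 1) := by
    intro s hs
    by_contra hle
    exact hfirst s (by omega) ⟨by omega, fun u hu => (ht u hu).trans (not_lt.1 hle)⟩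
  have hsucc := excess_succ a w ⟨m, htn⟩
  have hm : w ⟨m, htn⟩ = a := eq_of_letterSign_pos (a := a) (by
    have := hlt m le_rfl
    simp only at hsucc
    omega)
  rw [hm, letterSign_self] at hsucc
  refine ⟨⟨m, htn⟩, ⟨fun s hs => ?_, fun s _ hs => ht s hs⟩, hm⟩
  have := hlt s hs
  simp only at hsucc ⊢
  omega

theorem exists_isPivot_eq_succ {n a : ℕ} {w : Fin n → ℕ}
    (h : ∃ t ≤ n, excess a w n < excess a w t) : ∃ m, IsPivot a w m ∧ w m = a + 1 := by
  classical
  obtain ⟨t₀, ht₀, hlt⟩ := h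
  obtain ⟨t₁, ht₁, hmax⟩ := (Finset.range (n + 1)).exists_max_image (excess a w) ⟨0, by simp⟩
  have ht₁n : t₁ ≤ n := by simpa [Nat.lt_succ_iff] using ht₁
  -- The pivot is the step out of the last maximum of the excess, which by hypothesis is not at `n`.
  let p : ℕ → Prop := fun t => ∀ s ≤ n, excess a w s ≤ excess a w t
  have hp : p (Nat.findGreatest p n) :=
    Nat.findGreatest_spec (P := p) ht₁n fun s hs => hmax s (by simpa [Nat.lt_succ_iff] using hs)
  have hle := Nat.findGreatest_le (P := p) n
  have hlast : ∀ s, Nat.findGreatest p n < s → s ≤ n → ¬ p s := fun s =>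
    Nat.findGreatest_is_greatest
  generalize Nat.findGreatest p n = m at hp hle hlast
  have hmn : m < n := lt_of_le_of_ne hle fun h => by
    have := hp t₀ ht₀
    subst h
    omega
  have hlt' : ∀ s, m < s → s ≤ n → excess a w s < excess a w m := by
    intro s hs hsn
    by_contra hge
    exact hlast s hs hsn fun u hu => (hp u hu).trans (not_lt.1 hge)
  have hsucc := excess_succ a w ⟨m, hmn⟩
  have hm : w ⟨m, hmn⟩ = a + 1 := eq_of_letterSign_neg (a := a) (by
    have := hlt' (m + 1) (by omega) hmn
    simp only at hsucc
    omega)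
  rw [hm, letterSign_succ] at hsucc
  refine ⟨⟨m, hmn⟩, ⟨fun s hs => hp s (by simp only at hs; omega), fun s hs hsn => ?_⟩, hm⟩
  have := hlt' s hs hsn
  simp only at hsucc ⊢
  omega

/-! ### Counting words with the crystal operators -/

theorem content_update {n : ℕ} (w : Fin n → ℕ) (m : Fin n) (x : ℕ) :
    content (Function.update w m x) + Finsupp.single (w m) 1 =
      content w + Finsupp.single x 1 := by
  rw [content, content, ← Finset.add_sum_erase _ _ (Finset.mem_univ m),
    ← Finset.add_sum_erase _ (fun j => Finsupp.single (w j) 1) (Finset.mem_univ m),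
    Finset.sum_congr rfl fun j hj => by rw [Function.update_of_ne (Finset.ne_of_mem_erase hj)]]
  simp only [Function.update_self]
  abel

/-- A relation serves better than a function here: the pivot is only known to exist and to be
unique. -/
theorem ncard_eq_of_rel {α β : Type*} {s : Set α} {t : Set β} (R : α → β → Prop)
    (hs : ∀ x ∈ s, ∃ y ∈ t, R x y) (ht : ∀ y ∈ t, ∃ x ∈ s, R x y)
    (h₁ : ∀ x y z, R x y → R x z → y = z) (h₂ : ∀ x y z, R x z → R y z → x = y) :
    s.ncard = t.ncard := by
  choose f hf hR using hs
  refine Set.ncard_congr f hf (fun x y hx hy h => ?_) fun y hy => ?_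
  · exact h₂ _ _ _ (hR x hx) (h ▸ hR y hy)
  · obtain ⟨x, hx, hxy⟩ := ht y hy
    exact ⟨x, hx, h₁ _ _ _ (hR x hx) hxy⟩

/-- The words in `X` with `r` letters `a` and `s` letters `a + 1` such that the excess of `a`
over `a + 1` reaches `p`. -/
def wordsReaching {n : ℕ} (X : Set (Fin n → ℕ)) (a r s p : ℕ) : Set (Fin n → ℕ) :=
  {w | w ∈ X ∧ (content w a = r ∧ content w (a + 1) = s) ∧ ∃ t ≤ n, (p : ℤ) ≤ excess a w t}

/-- Closure of a set of words under the crystal operators exchanging `a` and `a + 1`. -/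
def PivotInvariant {n : ℕ} (a : ℕ) (X : Set (Fin n → ℕ)) : Prop :=
  ∀ w m, IsPivot a w m → w m = a → (w ∈ X ↔ Function.update w m (a + 1) ∈ X)

/-- Exchanging `a` for `a + 1` at the pivot lowers the maximal excess by one. It can be undone
because on the right the final excess `r - (s + 1)` is below `p` by `h`, so the maximum is not
attained at the end and a pivot with letter `a + 1` exists. -/
theorem ncard_wordsReaching_succ {n a : ℕ} {X : Set (Fin n → ℕ)} (hX : PivotInvariant a X)
    {r s p : ℕ} (h : r ≤ p + s) :
    (wordsReaching X a (r + 1) s (p + 1)).ncard = (wordsReaching X a r (s + 1) p).ncard := by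
  refine ncard_eq_of_rel
    (fun w v => ∃ m, (IsPivot a w m ∧ w m = a) ∧ v = Function.update w m (a + 1)) ?_ ?_ ?_ ?_
  · rintro w ⟨hwX, ⟨hr, hs⟩, t, ht, hpt⟩
    obtain ⟨m, hm, hma⟩ := exists_isPivot_eq_self (a := a) (w := w)
      ⟨t, ht, by push_cast at hpt; omega⟩
    refine ⟨_, ⟨(hX w m hm hma).1 hwX, ?_, m, m.2.le, ?_⟩, m, ⟨hm, hma⟩, rfl⟩
    · have hc := content_update w m (a + 1)
      have h1 := DFunLike.congr_fun hc a
      have h2 := DFunLike.congr_fun hc (a + 1)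
      simp [hma] at h1 h2
      omega
    -- The prefix of length `m` is unaffected by the exchange, and its excess is one below the old
    -- maximum.
    · rw [excess_update, if_neg (by omega)]
      have h1 := excess_succ a w m
      rw [hma, letterSign_self] at h1
      push_cast at hpt
      rcases Nat.lt_or_ge m t with htm | htm
      · have := hm.2 t htm ht
        omega
      · have := hm.1 t htm
        omega
  · rintro v ⟨hvX, ⟨hr, hs⟩, t, ht, hpt⟩
    obtain ⟨m, hm, hma⟩ := exists_isPivot_eq_succ (a := a) (w := v)
      ⟨t, ht, by rw [excess_length, hr, hs]; push_cast; omega⟩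
    have hm' := (isPivot_update_iff (a := a) (w := v) a).2 hm
    have hself : Function.update (Function.update v m a) m (a + 1) = v := by
      rw [Function.update_idem, ← hma, Function.update_eq_self]
    refine ⟨Function.update v m a, ⟨?_, ?_, m + 1, m.2, ?_⟩, m, ⟨hm', by simp⟩, hself.symm⟩
    · rw [hX _ m hm' (by simp), hself]
      exact hvX
    · have hc := content_update v m a
      have h1 := DFunLike.congr_fun hc a
      have h2 := DFunLike.congr_fun hc (a + 1)
      simp [hma] at h1 h2
      omega
    · rw [excess_update, if_pos (by omega), hma]
      have h1 := excess_succ a v m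
      rw [hma, letterSign_succ] at h1
      simp only [letterSign_self, letterSign_succ]
      push_cast
      rcases Nat.lt_or_ge m t with htm | htm
      · have := hm.2 t htm ht
        omega
      · have := hm.1 t htm
        omega
  · rintro w _ _ ⟨m, ⟨hm, hma⟩, rfl⟩ ⟨m', ⟨hm', hma'⟩, rfl⟩
    rw [hm.eq_of_eq_self hm' hma hma']
  · rintro w w' _ ⟨m, ⟨hm, hma⟩, rfl⟩ ⟨m', ⟨hm', hma'⟩, h⟩
    have h1 := (isPivot_update_iff (a := a) (w := w) (a + 1)).2 hm
    have h2 := (isPivot_update_iff (a := a) (w := w') (a + 1)).2 hm'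
    rw [← h] at h2
    obtain rfl := h1.eq_of_eq_succ h2 (by simp) (by rw [h]; simp)
    have h3 := congrArg (Function.update · m a) h
    simp only [Function.update_idem] at h3
    rwa [← hma, Function.update_eq_self, hma, ← hma', Function.update_eq_self] at h3

theorem ncard_wordsReaching_add {n a : ℕ} {X : Set (Fin n → ℕ)} (hX : PivotInvariant a X)
    (k : ℕ) {r s : ℕ} (h : r ≤ s) :
    (wordsReaching X a (r + k) s k).ncard = (wordsReaching X a r (s + k) 0).ncard := by
  induction k generalizing s with
  | zero => rfl
  | succ k ih =>
    rw [← add_assoc, ncard_wordsReaching_succ hX (by omega), ih (by omega)]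
    congr 2
    omega

theorem ncard_content_swap {n a : ℕ} {X : Set (Fin n → ℕ)} (hX : PivotInvariant a X)
    (d : ℕ →₀ ℕ) :
    {w : Fin n → ℕ | content w = Finsupp.mapDomain (Equiv.swap a (a + 1)) d ∧ w ∈ X}.ncard =
      {w : Fin n → ℕ | content w = d ∧ w ∈ X}.ncard := by
  have key : ∀ d : ℕ →₀ ℕ, d (a + 1) ≤ d a →
      {w : Fin n → ℕ | content w = Finsupp.mapDomain (Equiv.swap a (a + 1)) d ∧ w ∈ X}.ncard =
        {w : Fin n → ℕ | content w = d ∧ w ∈ X}.ncard := by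
    intro d hd
    have hswap (x : ℕ) : Finsupp.mapDomain (Equiv.swap a (a + 1)) d x =
        d (Equiv.swap a (a + 1) x) := by
      rw [Finsupp.mapDomain_equiv_apply, Equiv.symm_swap]
    -- The other letters keep their multiplicities under the exchange, so they may be fixed
    -- throughout.
    let Y : Set (Fin n → ℕ) := {w | w ∈ X ∧ ∀ x, x ≠ a → x ≠ a + 1 → content w x = d x}
    have hY : PivotInvariant a Y := by
      intro w m hm hma
      refine and_congr (hX w m hm hma) (forall₃_congr fun x hxa hxa' => ?_)
      have hc := DFunLike.congr_fun (content_update w m (a + 1)) x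
      simp [hma, hxa.symm, hxa'.symm] at hc
      rw [hc]
    have h := ncard_wordsReaching_add hY (d a - d (a + 1)) (le_refl (d (a + 1)))
    rw [Nat.add_sub_cancel' hd] at h
    -- At both ends of the iteration the threshold is automatic: here the whole word has excess `d a
    -- - d (a + 1)`, and for `e₂` the empty prefix has excess `0`.
    have e₁ : wordsReaching Y a (d a) (d (a + 1)) (d a - d (a + 1)) =
        {w : Fin n → ℕ | content w = d ∧ w ∈ X} := by
      ext w
      constructor
      · rintro ⟨⟨hwX, hw⟩, ⟨h1, h2⟩, -⟩
        refine ⟨Finsupp.ext fun x => ?_, hwX⟩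
        by_cases hxa : x = a
        · rwa [hxa]
        by_cases hxa' : x = a + 1
        · rwa [hxa']
        exact hw x hxa hxa'
      · rintro ⟨rfl, hwX⟩
        refine ⟨⟨hwX, fun _ _ _ => rfl⟩, ⟨rfl, rfl⟩, n, le_rfl, ?_⟩
        rw [excess_length, Nat.cast_sub hd]
    have e₂ : wordsReaching Y a (d (a + 1)) (d a) 0 =
        {w : Fin n → ℕ | content w = Finsupp.mapDomain (Equiv.swap a (a + 1)) d ∧ w ∈ X} := by
      ext w
      constructor
      · rintro ⟨⟨hwX, hw⟩, ⟨h1, h2⟩, -⟩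
        refine ⟨Finsupp.ext fun x => ?_, hwX⟩
        rw [hswap]
        by_cases hxa : x = a
        · rwa [hxa, Equiv.swap_apply_left]
        by_cases hxa' : x = a + 1
        · rwa [hxa', Equiv.swap_apply_right]
        rw [Equiv.swap_apply_of_ne_of_ne hxa hxa']
        exact hw x hxa hxa'
      · rintro ⟨hw, hwX⟩
        refine ⟨⟨hwX, fun x hxa hxa' => ?_⟩, ⟨?_, ?_⟩, 0, Nat.zero_le _, by simp⟩
        · rw [hw, hswap, Equiv.swap_apply_of_ne_of_ne hxa hxa']
        · rw [hw, hswap, Equiv.swap_apply_left]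
        · rw [hw, hswap, Equiv.swap_apply_right]
    rw [← e₁, ← e₂, h]
  rcases le_total (d (a + 1)) (d a) with hd | hd
  · exact key d hd
  · have h := key (Finsupp.mapDomain (Equiv.swap a (a + 1)) d) (by
      simpa [Finsupp.mapDomain_equiv_apply] using hd)
    rw [← Finsupp.mapDomain_comp, ← Equiv.coe_trans, Equiv.swap_swap, Equiv.coe_refl,
      Finsupp.mapDomain_id] at h
    exact h.symm

/-! ### Crystal operators preserve monotone subsequences -/

section Exchange

variable {α β : Type*} [LinearOrder α] [LinearOrder β]

/-- Raising `m` only hurts if `I` uses later copies of `lo`. Up to the last of these, at `t`, there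
are at least as many copies of `hi` after `m`, and they can replace the copies of `lo`: `I` has
letters at most `lo` up to `t` and at least `hi` beyond. -/
theorem exists_monotoneOn_update [Fintype α] {lo hi : β} (hlt : lo < hi)
    (hcov : ∀ x, x ≤ lo ∨ hi ≤ x) {w : α → β} {m : α} (hm : w m = lo)
    (hcount : ∀ t, m < t → (Finset.univ.filter fun j => (m < j ∧ j ≤ t) ∧ w j = lo).card ≤
      (Finset.univ.filter fun j => (m < j ∧ j ≤ t) ∧ w j = hi).card)
    {I : Finset α} (hI : MonotoneOn w I) :
    ∃ J : Finset α, I.card ≤ J.card ∧ MonotoneOn (Function.update w m hi) J := by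
  by_cases hmI : m ∈ I
  swap
  · exact ⟨I, le_rfl, hI.congr fun x hx => (Function.update_of_ne (by grind) _ _).symm⟩
  have hlo {x : α} (hx : x ∈ I) (hmx : m < x) (hne : w x ≠ lo) : hi ≤ w x := by
    have := hI hmI hx hmx.le
    grind
  by_cases hex : ∃ j ∈ I, m < j ∧ w j = lo
  swap
  · refine ⟨I, le_rfl, fun x hx y hy hxy => ?_⟩
    have := hI hx hy hxy
    grind [Function.update_apply]
  let A := I.filter fun j => m < j ∧ w j = lo
  have hA : A.Nonempty := by
    obtain ⟨j, hj, h⟩ := hex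
    exact ⟨j, Finset.mem_filter.2 ⟨hj, h⟩⟩
  obtain ⟨htI, hmt, htlo⟩ : A.max' hA ∈ I ∧ m < A.max' hA ∧ w (A.max' hA) = lo := by
    simpa [A] using A.max'_mem hA
  have htmax : ∀ j ∈ A, j ≤ A.max' hA := fun j hj => A.le_max' j hj
  generalize A.max' hA = t at htI hmt htlo htmax
  let K := Finset.univ.filter fun j => (m < j ∧ j ≤ t) ∧ w j = hi
  have hAK : A.card ≤ K.card := le_trans (Finset.card_le_card fun j hj => by
    have := htmax j hj
    simp only [A, Finset.mem_filter] at hj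
    simp [hj, this]) (hcount t hmt)
  have hle {x : α} (hx : x ∈ I) (hxt : x ≤ t) : w x ≤ lo := htlo ▸ hI hx htI hxt
  have hdisj : Disjoint (I \ A) K := by
    rw [Finset.disjoint_left]
    intro j hj hjK
    simp only [K, Finset.mem_filter] at hjK
    have := hle (Finset.mem_sdiff.1 hj).1 hjK.2.1.2
    grind
  refine ⟨(I \ A) ∪ K, ?_, ?_⟩
  · rw [Finset.card_union_of_disjoint hdisj,
      Finset.card_sdiff_of_subset (Finset.filter_subset _ _)]
    have : A.card ≤ I.card := Finset.card_le_card (Finset.filter_subset _ _)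
    change _ ≤ I.card - A.card + _
    omega
  · intro x hx y hy hxy
    simp only [Finset.coe_union, Set.mem_union, Finset.mem_coe, Finset.mem_sdiff, A, K,
      Finset.mem_filter, Finset.mem_univ, true_and] at hx hy
    rcases hx with ⟨hx, hxA⟩ | hx <;> rcases hy with ⟨hy, hyA⟩ | hy
    · have := hI hx hy hxy
      grind [Function.update_apply]
    · have := hle hx (hxy.trans hy.1.2)
      grind [Function.update_apply]
    · have := hlo (x := y) hy (by grind)
      grind [Function.update_apply]
    · grind [Function.update_apply]

/-- Raising `m` only hurts if `I` has an earlier `hi`, at `j`. No letter lies strictly between `lo`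
and `hi`, so `I` has no position between `j` and `m`, and `m` can be traded for a `lo` found there.
-/
theorem exists_strictAntiOn_update {lo hi : β} (hlt : lo < hi)
    (hcov : ∀ x, x ≤ lo ∨ hi ≤ x) {w : α → β} {m : α} (hm : w m = lo)
    (hex : ∀ j, j < m → w j = hi → ∃ i, (j < i ∧ i < m) ∧ w i = lo)
    {I : Finset α} (hI : StrictAntiOn w I) :
    ∃ J : Finset α, I.card ≤ J.card ∧ StrictAntiOn (Function.update w m hi) J := by
  by_cases hmI : m ∈ I
  swap
  · exact ⟨I, le_rfl, hI.congr fun x hx => (Function.update_of_ne (by grind) _ _).symm⟩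
  by_cases hj : ∃ j ∈ I, j < m ∧ w j = hi
  swap
  · refine ⟨I, le_rfl, fun x hx y hy hxy => ?_⟩
    have := hI hx hy hxy
    have := hcov (w x)
    grind [Function.update_apply]
  obtain ⟨j, hjI, hjm, hjhi⟩ := hj
  obtain ⟨i, ⟨hji, him⟩, hilo⟩ := hex j hjm hjhi
  have hle {x : α} (hx : x ∈ I) (hxm : x < m) : x ≤ j := by
    by_contra h
    have h1 := hI hx hmI hxm
    have h2 := hI hjI hx (not_le.1 h)
    have := hcov (w x)
    grind
  have hiI : i ∉ I := fun h => (hle h him).not_gt hji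
  refine ⟨insert i (I.erase m), ?_, ?_⟩
  · rw [Finset.card_insert_of_notMem (by grind), Finset.card_erase_add_one hmI]
  · intro x hx y hy hxy
    simp only [Finset.coe_insert, Finset.coe_erase, Set.mem_insert_iff, Set.mem_sdiff,
      Finset.mem_coe, Set.mem_singleton_iff] at hx hy
    rcases hx with rfl | ⟨hx, hxm⟩ <;> rcases hy with rfl | ⟨hy, hym⟩
    · exact absurd hxy (lt_irrefl _)
    · have h1 : m < y := by
        by_contra h
        have := hle hy (lt_of_le_of_ne (not_lt.1 h) hym)
        order
      have := hI hmI hy h1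
      grind [Function.update_apply]
    · have h1 : x ≤ j := hle hx (hxy.trans him)
      have := hI.antitoneOn hx hjI h1
      grind [Function.update_apply]
    · have := hI hx hy hxy
      grind [Function.update_apply]

end Exchange

theorem IsPivot.card_le_after {n a : ℕ} {w : Fin n → ℕ} {m : Fin n} (h : IsPivot a w m)
    {t : Fin n} (ht : m < t) :
    (Finset.univ.filter fun j : Fin n => (m < j ∧ j ≤ t) ∧ w j = a).card ≤
      (Finset.univ.filter fun j : Fin n => (m < j ∧ j ≤ t) ∧ w j = a + 1).card := by
  have h1 := h.2 (t + 1) (by simpa using ht.le) t.2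
  have h2 := excess_sub_excess a w (s := m + 1) (t := t + 1) (by simpa using ht.le)
  simp only [Fin.lt_def, Fin.le_def, Nat.succ_le_iff, Nat.lt_succ_iff] at h2 ⊢
  omega

theorem IsPivot.card_le_before {n a : ℕ} {w : Fin n → ℕ} {m : Fin n} (h : IsPivot a w m)
    {t : Fin n} (ht : t < m) :
    (Finset.univ.filter fun j : Fin n => (j < m ∧ t ≤ j) ∧ w j = a + 1).card ≤
      (Finset.univ.filter fun j : Fin n => (j < m ∧ t ≤ j) ∧ w j = a).card := by
  have h1 := h.1 t ht.le
  have h2 := excess_sub_excess a w (s := t) (t := m) ht.le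
  simp only [Fin.lt_def, Fin.le_def, and_comm (a := _ < m.1)] at h2 ⊢
  omega

theorem exists_of_card_le {α : Type*} [Fintype α] {p q : α → Prop} [DecidablePred p]
    [DecidablePred q] (h : (Finset.univ.filter p).card ≤ (Finset.univ.filter q).card)
    (hp : ∃ x, p x) : ∃ x, q x := by
  obtain ⟨x, hx⟩ := hp
  have : 0 < (Finset.univ.filter p).card := Finset.card_pos.2 ⟨x, by simpa using hx⟩
  obtain ⟨y, hy⟩ := Finset.card_pos.1 (this.trans_le h)
  exact ⟨y, by simpa using hy⟩

theorem pivotInvariant_of_forall {n a : ℕ} {p : (Fin n → ℕ) → Prop}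
    (h₁ : ∀ w m, IsPivot a w m → w m = a → p w → p (Function.update w m (a + 1)))
    (h₂ : ∀ w m, IsPivot a w m → w m = a + 1 → p w → p (Function.update w m a)) :
    PivotInvariant a {w | ¬ p w} := by
  refine fun w m hm hma => not_congr ⟨h₁ w m hm hma, fun h => ?_⟩
  have := h₂ _ m ((isPivot_update_iff _).2 hm) (by simp) h
  rwa [Function.update_idem, ← hma, Function.update_eq_self] at this

/-- This allows the exchanged subsequence to be longer than the original one. -/
theorem exists_card_eq_iff_le {α : Type*} {p : Finset α → Prop}
    (hp : ∀ I J, J ⊆ I → p I → p J) (k : ℕ) :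
    (∃ I : Finset α, I.card = k ∧ p I) ↔ ∃ I : Finset α, k ≤ I.card ∧ p I := by
  constructor
  · rintro ⟨I, h, hI⟩
    exact ⟨I, h.ge, hI⟩
  · rintro ⟨I, h, hI⟩
    obtain ⟨J, hJ, hc⟩ := Finset.exists_subset_card_eq h
    exact ⟨J, hc, hp I J hJ hI⟩

theorem pivotInvariant_avoids_iota (n k a : ℕ) :
    PivotInvariant a {w : Fin n → ℕ | Avoids (Tuple.sort w) {⟨k, iota k⟩}} := by
  simp only [avoids_singleton, contains_sort_iota_iff]
  simp only [exists_card_eq_iff_le (p := fun I : Finset (Fin n) => MonotoneOn _ (I : Set (Fin n)))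
    fun I J h hI => hI.mono (Finset.coe_subset.2 h)]
  refine pivotInvariant_of_forall ?_ ?_
  · rintro w m hm hma ⟨I, hk, hI⟩
    obtain ⟨J, hJ, h⟩ := exists_monotoneOn_update (Nat.lt_succ_self a) (by omega) hma
      (fun t ht => hm.card_le_after ht) hI
    exact ⟨J, hk.trans hJ, h⟩
  · rintro w m hm hma ⟨I, hk, hI⟩
    -- Reversing both positions and letters preserves monotonicity and turns lowering `a + 1` to `a`
    -- into raising.
    obtain ⟨J, hJ, h⟩ := exists_monotoneOn_update (α := (Fin n)ᵒᵈ) (β := ℕᵒᵈ)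
      (lo := OrderDual.toDual (a + 1)) (hi := OrderDual.toDual a)
      (OrderDual.toDual_lt_toDual.2 (Nat.lt_succ_self a))
      (fun x => show a + 1 ≤ OrderDual.ofDual x ∨ OrderDual.ofDual x ≤ a by omega)
      (w := w) (m := m) hma (fun t ht => hm.card_le_before (t := t) ht) hI.dual
    exact ⟨J, hk.trans hJ, h.dual⟩

theorem pivotInvariant_avoids_delta (n k a : ℕ) :
    PivotInvariant a {w : Fin n → ℕ | Avoids (Tuple.sort w) {⟨k, delta k⟩}} := by
  simp only [avoids_singleton, contains_sort_delta_iff]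
  simp only [exists_card_eq_iff_le (p := fun I : Finset (Fin n) => StrictAntiOn _ (I : Set (Fin n)))
    fun I J h hI => hI.mono (Finset.coe_subset.2 h)]
  refine pivotInvariant_of_forall ?_ ?_
  · rintro w m hm hma ⟨I, hk, hI⟩
    obtain ⟨J, hJ, h⟩ := exists_strictAntiOn_update (Nat.lt_succ_self a) (by omega) hma
      -- On the positions from `j` up to but excluding `m` the letter `a` is at least as frequent as
      -- `a + 1`, which occurs at `j`.
      (fun j hj hja => by
        obtain ⟨i, ⟨him, hji⟩, hi⟩ := exists_of_card_le (hm.card_le_before hj)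
          ⟨j, ⟨hj, le_rfl⟩, hja⟩
        refine ⟨i, ⟨lt_of_le_of_ne hji ?_, him⟩, hi⟩
        rintro rfl
        omega) hI
    exact ⟨J, hk.trans hJ, h⟩
  · rintro w m hm hma ⟨I, hk, hI⟩
    obtain ⟨J, hJ, h⟩ := exists_strictAntiOn_update (α := (Fin n)ᵒᵈ) (β := ℕᵒᵈ)
      (lo := OrderDual.toDual (a + 1)) (hi := OrderDual.toDual a)
      (OrderDual.toDual_lt_toDual.2 (Nat.lt_succ_self a))
      (fun x => show a + 1 ≤ OrderDual.ofDual x ∨ OrderDual.ofDual x ≤ a by omega)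
      (w := w) (m := m) hma
      (fun j (hj : m < OrderDual.ofDual j) (hja : w (OrderDual.ofDual j) = a) => by
        obtain ⟨i, ⟨him, hji⟩, hi⟩ := exists_of_card_le (hm.card_le_after hj)
          ⟨_, ⟨hj, le_rfl⟩, hja⟩
        refine ⟨OrderDual.toDual i,
          ⟨show i < OrderDual.ofDual j from lt_of_le_of_ne hji fun h => ?_, him⟩, hi⟩
        rw [h] at hi
        exact absurd (hja.symm.trans hi) (by omega)) hI.dual
    exact ⟨J, hk.trans hJ, h.dual⟩

/-! ### From adjacent transpositions to all permutations -/

/-- A function of exponent vectors that is invariant under adjacent transpositions is invariant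
under all permutations. -/
theorem mapDomain_invariant_of_adjacent {γ : Type*} (c : (ℕ →₀ ℕ) → γ)
    (h : ∀ a d, c (Finsupp.mapDomain (Equiv.swap a (a + 1)) d) = c d) (e : Equiv.Perm ℕ)
    (d : ℕ →₀ ℕ) : c (Finsupp.mapDomain e d) = c d := by
  let G : Subgroup (Equiv.Perm ℕ) :=
    { carrier := {e | ∀ d, c (Finsupp.mapDomain e d) = c d}
      one_mem' := fun d => by rw [Equiv.Perm.coe_one, Finsupp.mapDomain_id]
      mul_mem' := fun {e f} he hf d => by
        rw [Equiv.Perm.coe_mul, Finsupp.mapDomain_comp, he, hf]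
      inv_mem' := fun {e} he d => by
        rw [← he, ← Finsupp.mapDomain_comp, ← Equiv.Perm.coe_mul, mul_inv_cancel,
          Equiv.Perm.coe_one, Finsupp.mapDomain_id] }
  have hadj (a : ℕ) : Equiv.swap a (a + 1) ∈ G := h a
  have hswap' (a k : ℕ) : Equiv.swap a (a + k) ∈ G := by
    induction k with
    | zero =>
      rw [add_zero, Equiv.swap_self]
      exact G.one_mem
    | succ k ih =>
      rcases k with _ | k
      · exact hadj a
      · rw [Equiv.swap_comm, ← Equiv.swap_mul_swap_mul_swap (y := a + (k + 1)) (by omega) (by omega)]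
        exact G.mul_mem (G.mul_mem (hadj _) ih) (hadj _)
  have hswap (a b : ℕ) : Equiv.swap a b ∈ G := by
    rcases le_total a b with hab | hab <;> obtain ⟨k, rfl⟩ := Nat.exists_eq_add_of_le hab
    · exact hswap' a k
    · rw [Equiv.swap_comm]; exact hswap' b k
  have hfin (f : Equiv.Perm ℕ) (hf : (MulAction.fixedBy ℕ f)ᶜ.Finite) : f ∈ G := by
    rw [← mem_closure_isSwap'] at hf
    refine (Subgroup.closure_le G).2 ?_ hf
    rintro _ ⟨a, b, -, rfl⟩
    exact hswap a b
  -- Only the values of `e` on the finite support of `d` matter. They extend to a permutation of the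
  -- finite set `B`, hence to a finitary permutation of the letters, which is a product of
  -- transpositions.
  let B := d.support ∪ d.support.image e
  obtain ⟨g, hg⟩ := Set.MapsTo.exists_equiv_extend_of_card_eq (α := B) (t := B)
    (Fintype.card_coe B) (s := {x | x.1 ∈ d.support}) (f := fun x => e x)
    (fun x hx => Finset.mem_union_right _ (Finset.mem_image_of_mem e hx))
    fun x _ y _ hxy => Subtype.ext (e.injective hxy)
  have hcongr : Finsupp.mapDomain e d = Finsupp.mapDomain (Equiv.Perm.ofSubtype g) d :=
    Finsupp.mapDomain_congr fun x hx => by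
      rw [Equiv.Perm.ofSubtype_apply_of_mem g (Finset.mem_union_left _ hx),
        hg ⟨x, Finset.mem_union_left _ hx⟩ hx]
  rw [hcongr]
  refine hfin _ (B.finite_toSet.subset fun x hx => ?_) d
  by_contra hxB
  exact hx (Equiv.Perm.ofSubtype_apply_of_not_mem g hxB)

theorem isSymmetricFunction_Q_of_pivotInvariant {n : ℕ} {P : Set Pattern}
    (h : ∀ a, PivotInvariant a {w : Fin n → ℕ | Avoids (Tuple.sort w) P}) :
    IsSymmetricFunction (Q n P) :=
  (isSymmetricFunction_Q_iff n P).2 <| mapDomain_invariant_of_adjacent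
    (fun d => {w : Fin n → ℕ | content w = d ∧ Avoids (Tuple.sort w) P}.ncard)
    fun a d => ncard_content_swap (h a) d

end PatternQSym

theorem mainTheorem6 (P : Set PatternQSym.Pattern) (hP : P.encard = 1) :
    (∀ n : ℕ, PatternQSym.IsSymmetricFunction (PatternQSym.Q n P)) ↔
      ∃ k : ℕ, P = {⟨k, PatternQSym.iota k⟩} ∨ P = {⟨k, PatternQSym.delta k⟩} := by
  constructor
  · intro h
    obtain ⟨⟨k, π⟩, rfl⟩ := Set.encard_eq_one.1 hP
    rcases PatternQSym.eq_iota_or_delta_of_isSymmetric (h k) with rfl | rfl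
    · exact ⟨k, Or.inl rfl⟩
    · exact ⟨k, Or.inr rfl⟩
  · rintro ⟨k, rfl | rfl⟩ n
    · exact PatternQSym.isSymmetricFunction_Q_of_pivotInvariant fun a =>
        PatternQSym.pivotInvariant_avoids_iota n k a
    · exact PatternQSym.isSymmetricFunction_Q_of_pivotInvariant fun a =>
        PatternQSym.pivotInvariant_avoids_delta n k a
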